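/- Let $\mathfrak c=2^{\aleph_0}$. Fix a partition $\{P_0,P_1\}$ of $\mathfrak c$ (the set of ordinals below $\mathfrak c$) with $|P_0|=|P_1|=\mathfrak c$ and $\omega+1\subseteq P_1$, a partition $\{R_0,R_1\}$ of $2^{\mathfrak c}\setminus\mathfrak c$ with $|R_0|=|R_1|=2^{\mathfrak c}$, a partition $\{C_{n,m}: n>1,\ m\ge 1\}$ of $P_0$ into sets of cardinality $\mathfrak c$, and a set $C_1\subseteq P_1$ with $\omega\subseteq C_1$ and $|C_1|=|P_1\setminus C_1|=\mathfrak c$. For a set $I$ and an Abelian group $G$, $G^{(I)}$ denotes the group of finitely supported functions $I\to G$. Let $$\mathbf X=\bigoplus_{n>1,\,m\ge 1}(\mathbb Q/\mathbb Z)^{(C_{n,m}\times m)}\oplus\mathbb Q^{(P_1)}\oplus(\mathbb Q/\mathbb Z)^{(R_0)}\oplus\mathbb Q^{(R_1)},$$ where $m=\{0,\dots,m-1\}$. For $\mu\in P_1$ let $\chi_\mu\in\mathbf X$ be the element whose $\mu$-th coordinate is $1$ and whose other coordinates are $0$. For $\mu\in P_0$ and $n\ge 1$ let $[\frac1n\chi_{(\mu,0)}]\in\mathbf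 X$ be the element whose $(\mu,0)$-th coordinate is $\frac1n+\mathbb Z$ and whose other coordinates are $0$. For an Abelian group $G$ let $r(G)$ be its free rank, $G[n]=\{x\in G: nx=0\}$, and let $D_G$ be the set of all integers $n>1$ such that $G$ contains an isomorphic copy of $\mathbb Z_n^{(\mathfrak c)}$. A subgroup $L$ of $\mathbf X$ is called large if $2^{\mathfrak c}\ge|L|\ge r(L)\ge\mathfrak c$, for all positive integers $d\mid n$ the group $dL[n]$ is either finite or of cardinality at least $\mathfrak c$, and there are positive integers $k_n$ $(n\in D_L)$ such that $\chi_\mu\in L$ for all $\mu\in C_1$ and $[\frac1n\chi_{(\mu,0)}]\in L$ for all $n\in D_L$ and $\mu\in C_{n,k_n}$. Let $H$ be an Abelian group with $2^{\mathfrak c}\ge|H|\ge r(H)\ge\mathfrak c$. Then there are positive integers $k_n$ $(n\in D_H)$ and a group monomorphism $\varphi:H\to\mathbf X$ such that i) $\chi_\mu\in\varphi[H]$ for all $\mu\in C_1$, and ii) $[\frac1n\chi_{(\mu,0)}]\in\varphi[H]$ for all $n\in D_H$ and $\mu\in C_{n,k_n}$. Consequently, if moreover for all positive integers $d\mid n$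 the group $dH[n]$ is either finite or of cardinality at least $\mathfrak c$, then $H$ is isomorphic to a large subgroup of $\mathbf X$. -/

import Mathlib

open Cardinal

universe u

/-- The fixed combinatorial data: a partition `{P₀, P₁}` of `𝔠`, a partition `{R₀, R₁}` of
`2 ^ 𝔠 \ 𝔠`, a partition `{C n m : n > 1, m ≥ 1}` of `P₀` into pieces of cardinality `𝔠`, and a set
`C₁ ⊆ P₁`.  The cardinals `𝔠` and `2 ^ 𝔠` are identified with the sets of ordinals below their
initial ordinals.  (The values `C n m` for `n ≤ 1` or `m = 0` are irrelevant.) -/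
structure IndexData where
  P₀ : Set Ordinal.{0}
  P₁ : Set Ordinal.{0}
  R₀ : Set Ordinal.{0}
  R₁ : Set Ordinal.{0}
  C : ℕ → ℕ → Set Ordinal.{0}
  C₁ : Set Ordinal.{0}
  P_union : P₀ ∪ P₁ = Set.Iio (continuum.{0}).ord
  P_disjoint : Disjoint P₀ P₁
  card_P₀ : #P₀ = continuum
  card_P₁ : #P₁ = continuum
  omega_succ_subset : Set.Iio (Ordinal.omega0 + 1) ⊆ P₁
  R_union : R₀ ∪ R₁ = Set.Ico (continuum.{0}).ord ((2 : Cardinal.{0}) ^ continuum.{0}).ord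
  R_disjoint : Disjoint R₀ R₁
  card_R₀ : #R₀ = 2 ^ continuum
  card_R₁ : #R₁ = 2 ^ continuum
  C_union : {μ | ∃ n m, 1 < n ∧ 1 ≤ m ∧ μ ∈ C n m} = P₀
  C_disjoint : ∀ n m n' m', 1 < n → 1 ≤ m → 1 < n' → 1 ≤ m' → (n, m) ≠ (n', m') →
    Disjoint (C n m) (C n' m')
  card_C : ∀ n m, 1 < n → 1 ≤ m → #(C n m) = continuum
  C₁_subset : C₁ ⊆ P₁
  omega_subset_C₁ : Set.Iio Ordinal.omega0 ⊆ C₁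
  card_C₁ : #C₁ = continuum
  card_P₁_diff_C₁ : #(P₁ \ C₁ : Set Ordinal.{0}) = continuum

/-- The group `ℚ / ℤ`. -/
abbrev QmodZ : Type := AddCircle (1 : ℚ)

namespace IndexData

/-- `𝕎 = (ℚ/ℤ)^(P₀ × ω) ⊕ ℚ^(P₁) ⊕ (ℚ/ℤ)^(R₀) ⊕ ℚ^(R₁)`. -/
abbrev W (S : IndexData) : Type 1 :=
  ((S.P₀ × ℕ) →₀ QmodZ) × (S.P₁ →₀ ℚ) × (S.R₀ →₀ QmodZ) × (S.R₁ →₀ ℚ)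

/-- `𝕏 = ℚ^(P₀ × ω) ⊕ ℚ^(P₁) ⊕ ℚ^(R₀) ⊕ ℚ^(R₁)`. -/
abbrev RatX (S : IndexData) : Type 1 :=
  ((S.P₀ × ℕ) →₀ ℚ) × (S.P₁ →₀ ℚ) × (S.R₀ →₀ ℚ) × (S.R₁ →₀ ℚ)

/-- The homomorphism `w ↦ [w]` from `𝕏` onto `𝕎`: it reduces the coordinates in
`(P₀ × ω) ∪ R₀` modulo `ℤ` and keeps those in `P₁ ∪ R₁`. -/
noncomputable def bracket (S : IndexData) : S.RatX →+ S.W :=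
  (Finsupp.mapRange.addMonoidHom (QuotientAddGroup.mk' (AddSubgroup.zmultiples (1 : ℚ)))).prodMap
    ((AddMonoidHom.id _).prodMap
      ((Finsupp.mapRange.addMonoidHom
        (QuotientAddGroup.mk' (AddSubgroup.zmultiples (1 : ℚ)))).prodMap
        (AddMonoidHom.id _)))

/-- `χ_μ` for `μ ∈ P₁`, as an element of `𝕏`. -/
noncomputable def chiOne (S : IndexData) (μ : S.P₁) : S.RatX :=
  (0, Finsupp.single μ 1, 0, 0)

/-- `χ_(μ,i)` for `(μ, i) ∈ P₀ × ω`, as an element of `𝕏`. -/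
noncomputable def chiZero (S : IndexData) (μ : S.P₀) (i : ℕ) : S.RatX :=
  (Finsupp.single (μ, i) 1, 0, 0, 0)

/-- The main group
`𝐗 = ⨁_{n > 1, m ≥ 1} (ℚ/ℤ)^(C n m × m) ⊕ ℚ^(P₁) ⊕ (ℚ/ℤ)^(R₀) ⊕ ℚ^(R₁)`, as the subgroup of `𝕎` of
the elements whose support within `P₀ × ω` lies in `⋃_{n > 1, m ≥ 1} C n m × {0, …, m - 1}`. -/
def X (S : IndexData) : AddSubgroup S.W where
  carrier := {w | ∀ x : S.P₀ × ℕ, w.1 x ≠ 0 →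
    ∃ n m, 1 < n ∧ 1 ≤ m ∧ (x.1 : Ordinal.{0}) ∈ S.C n m ∧ x.2 < m}
  zero_mem' := fun x hx => absurd rfl hx
  add_mem' := by
    intro a b ha hb x hx
    by_cases h : a.1 x = 0
    · refine hb x fun h' => hx ?_
      simp [h, h']
    · exact ha x h
  neg_mem' := by
    intro a ha x hx
    refine ha x fun h => hx ?_
    simp [h]

end IndexData

/-- The set `D` of all integers `n > 1` such that `G` contains an isomorphic copy of
`ℤ_n^(𝔠)` (the index set `ℝ` has cardinality `𝔠`). -/
def ordersD (G : Type u) [AddCommGroup G] : Set ℕ :=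
  {n | 1 < n ∧ ∃ f : (ℝ →₀ ZMod n) →+ G, Function.Injective f}

/-- `2 ^ 𝔠 ≥ |G| ≥ r(G) ≥ 𝔠`, where the free rank `r(G)` is the rank of `G` as a `ℤ`-module. -/
def SizeCondition (G : Type u) [AddCommGroup G] : Prop :=
  #G ≤ 2 ^ continuum ∧ Module.rank ℤ G ≤ #G ∧ continuum ≤ Module.rank ℤ G

/-- For all positive integers `d ∣ n`, the group `d G[n] = {d x : n x = 0}` is finite or of
cardinality at least `𝔠`. -/
def TorsionCondition (G : Type u) [AddCommGroup G] : Prop :=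
  ∀ d n : ℕ, 0 < d → 0 < n → d ∣ n →
    ((fun x : G => d • x) '' {x : G | n • x = 0}).Finite ∨
      continuum ≤ #((fun x : G => d • x) '' {x : G | n • x = 0})

/-- Large subgroups of `𝐗`. -/
def IndexData.IsLarge (S : IndexData) (L : AddSubgroup S.X) : Prop :=
  SizeCondition L ∧ TorsionCondition L ∧
    ∃ k : ℕ → ℕ, (∀ n ∈ ordersD L, 1 ≤ k n) ∧
      (∀ μ : S.P₁, (μ : Ordinal.{0}) ∈ S.C₁ → ∃ x ∈ L, (x : S.W) = S.bracket (S.chiOne μ)) ∧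
      (∀ n ∈ ordersD L, ∀ μ : S.P₀, (μ : Ordinal.{0}) ∈ S.C n (k n) →
        ∃ x ∈ L, (x : S.W) = S.bracket ((1 / (n : ℚ)) • S.chiZero μ 0))

/-!
By transfinite recursion of length `𝔠`, choose elements `h μ` of `H` (`μ ∈ P₀ ∪ P₁`) which generate
a direct sum of cyclic groups, `h μ` having order `n` if `μ ∈ C n (k n)` with `n ∈ ordersD H`, and
infinite order if `μ ∈ P₁` (and `h μ = 0` for the other `μ ∈ P₀`). The recursion never stops: fewer
than `𝔠` elements span a subgroup of cardinality less than `𝔠`, while `H` contains `𝔠` independent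
elements of the required order, and distinct ones cannot all have a nonzero multiple in that
subgroup, since these multiples would be distinct. Sending `h μ` to `[1/n χ_(μ,0)]` or `χ_μ` is an
isomorphism of the span onto a subgroup of `(ℚ/ℤ)^(P₀) ⊕ ℚ^(P₁)`, which extends to a homomorphism
`g` on `H` because the target is divisible.

The kernel of `g` meets the span trivially. As `|H| ≤ 2 ^ 𝔠`, there is an embedding `θ` of `H` into
`(ℚ/ℤ)^(R₀) ⊕ ℚ^(R₁)`, and the homomorphism equal to `0` on the span and to `θ` on the kernel of `g`
extends to `H`, again by divisibility. Paired with `g` it gives the monomorphism.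

For `θ`, the component in `(ℚ/ℤ)^(R₀)` extends an embedding of the socle, hence is injective on the
torsion subgroup, and the component in `ℚ^(R₁)`, which comes from `ℚ ⊗ H`, has torsion kernel.
-/

universe v w t

theorem exists_forall_domRestrict_Iio {I : Type v} [Preorder I] [WellFoundedLT I] {α : Type u}
    {P : ∀ i : I, (Set.Iio i → α) → α → Prop} (h : ∀ i g, ∃ x, P i g x) :
    ∃ f : I → α, ∀ i, P i ((Set.Iio i).domRestrict f) (f i) := by
  choose next h_next using h
  let f : I → α := WellFoundedLT.fix fun i g => next i fun j => g j j.2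
  refine ⟨f, fun i => ?_⟩
  have f_eq : f i = next i ((Set.Iio i).domRestrict f) := WellFoundedLT.fix_eq _ i
  rw [f_eq]
  exact h_next i _

theorem mk_finsupp_le_of_countable (α : Type u) (β : Type v) [Countable β] [Zero β] :
    #(α →₀ β) ≤ max (lift.{v} #α) ℵ₀ := by
  rcases finite_or_infinite α with _ | _
  · exact mk_le_aleph0.trans (le_max_right _ _)
  rcases subsingleton_or_nontrivial β with _ | _
  · exact mk_le_aleph0.trans (le_max_right _ _)
  rw [mk_finsupp_lift_of_infinite]
  exact max_le_max_left _ (lift_le_aleph0.2 mk_le_aleph0)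

theorem mk_span_le_of_countable (R : Type t) {M : Type u} [Semiring R] [Countable R]
    [AddCommMonoid M] [Module R M] (s : Set M) : #(Submodule.span R s) ≤ max #s ℵ₀ := by
  rw [← lift_le.{t}]
  calc lift.{t} #(Submodule.span R s)
      = lift.{t} #(Set.range (Finsupp.linearCombination R ((↑) : s → M))) := by
        rw [← LinearMap.coe_range, Finsupp.range_linearCombination, Subtype.range_coe]
        rfl
    _ ≤ #(s →₀ R) := by
        rw [← lift_id'.{u, t} #(s →₀ R), ← lift_umax.{u, t}]
        exact mk_range_le_lift
    _ ≤ max (lift.{t} #s) ℵ₀ := mk_finsupp_le_of_countable s R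
    _ = lift.{t} (max #s ℵ₀) := by rw [lift_max, lift_aleph0]

theorem exists_linearIndependent_of_lift_le_rank (R : Type t) (M : Type u) [CommRing R]
    [IsDomain R] [AddCommGroup M] [Module R M] {J : Type w}
    (hJ : lift.{u} #J ≤ lift.{w} (Module.rank R M)) :
    ∃ v : J → M, LinearIndependent R v := by
  obtain ⟨s, hs, linearIndependent_s⟩ := exists_set_linearIndependent_of_isDomain R M
  obtain ⟨ι⟩ := lift_mk_le'.1 (hs ▸ hJ)
  exact ⟨_, linearIndependent_s.comp ι ι.injective⟩

section LinearIndependentMod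

variable {R : Type t} {M : Type u} {N : Type*} {I : Type v} {J : Type w} [CommRing R]
  [AddCommGroup M] [Module R M] [AddCommGroup N] [Module R N]

/-- The family `v` is linearly independent up to the relations `a i • v i = 0`, that is, the span of
`v` is the direct sum of its cyclic submodules, the `i`-th of which is a copy of `R ⧸ (a i)`. For
`a = 0` this is linear independence. -/
def LinearIndependentMod (a : I → R) (v : I → M) : Prop :=
  ∀ f : I →₀ R, Finsupp.linearCombination R v f = 0 ↔ ∀ i, a i ∣ f i

theorem linearIndependentMod_zero_iff {v : I → M} :
    LinearIndependentMod (fun _ => (0 : R)) v ↔ LinearIndependent R v := by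
  simp only [LinearIndependentMod, zero_dvd_iff, linearIndependent_iff, Finsupp.ext_iff,
    Finsupp.coe_zero, Pi.zero_apply]
  refine forall_congr' fun f => ⟨Iff.mp, fun h => ⟨h, fun hf => ?_⟩⟩
  rw [show f = 0 from Finsupp.ext hf, map_zero]

namespace LinearIndependentMod

theorem smul_eq_zero_iff {a : I → R} {v : I → M} (hv : LinearIndependentMod a v) (i : I) (c : R) :
    c • v i = 0 ↔ a i ∣ c := by
  classical
  have h := hv (Finsupp.single i c)
  rw [Finsupp.linearCombination_single] at h
  refine h.trans ⟨fun h => by simpa using h i, fun h j => ?_⟩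
  obtain rfl | hij := eq_or_ne i j <;> simp [*]

theorem ker_linearCombination_eq {a : I → R} {v : I → M} {w : I → N}
    (hv : LinearIndependentMod a v) (hw : LinearIndependentMod a w) :
    LinearMap.ker (Finsupp.linearCombination R v) = LinearMap.ker (Finsupp.linearCombination R w) :=
  Submodule.ext fun f => (hv f).trans (hw f).symm

theorem map {a : I → R} {v : I → M} (hv : LinearIndependentMod a v) (f : M →ₗ[R] N)
    (hf : Function.Injective f) : LinearIndependentMod a (f ∘ v) := fun c => by
  rw [← Finsupp.apply_linearCombination, map_eq_zero_iff f hf, hv]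

theorem of_forall_smul_mem_span_imp_dvd [LinearOrder I] {a : I → R} {v : I → M}
    (annihilates : ∀ i, a i • v i = 0)
    (dvd_of_mem : ∀ i c, c • v i ∈ Submodule.span R (v '' Set.Iio i) → a i ∣ c) :
    LinearIndependentMod a v := by
  classical
  have smul_eq_zero {i : I} {c : R} (h : a i ∣ c) : c • v i = 0 := by
    obtain ⟨d, rfl⟩ := h
    rw [mul_comm, mul_smul, annihilates, smul_zero]
  intro f
  refine ⟨fun hf => ?_, fun hf => ?_⟩
  · by_contra! ⟨i₀, hi₀⟩
    let bad := f.support.filter fun i => ¬ a i ∣ f i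
    have mem_bad {j : I} : j ∈ bad ↔ ¬ a j ∣ f j := by
      simp only [bad, Finset.mem_filter, Finsupp.mem_support_iff, and_iff_right_iff_imp]
      exact fun hj h0 => hj (h0 ▸ dvd_zero _)
    obtain ⟨i, hi, i_max⟩ := bad.exists_max_image id ⟨i₀, mem_bad.2 hi₀⟩
    refine mem_bad.1 hi (dvd_of_mem i _ ?_)
    rw [Finsupp.linearCombination_apply, Finsupp.sum,
      ← Finset.add_sum_erase _ _ (Finset.mem_filter.1 hi).1, add_eq_zero_iff_eq_neg] at hf
    rw [hf]
    refine Submodule.neg_mem _ (Submodule.sum_mem _ fun j hj => ?_)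
    rcases lt_or_gt_of_ne (Finset.ne_of_mem_erase hj) with hji | hij
    · exact Submodule.smul_mem _ _ (Submodule.subset_span ⟨j, hji, rfl⟩)
    · have dvd : a j ∣ f j := by
        by_contra hj'
        exact (i_max j (mem_bad.2 hj')).not_gt hij
      rw [smul_eq_zero dvd]
      exact Submodule.zero_mem _
  · rw [Finsupp.linearCombination_apply]
    exact Finset.sum_eq_zero fun i _ => smul_eq_zero (hf i)

theorem exists_forall_smul_mem_imp_dvd {a : R} {v : J → M}
    (hv : LinearIndependentMod (fun _ => a) v) (G : Submodule R M)
    (hG : lift.{w} #G < lift.{u} #J) : ∃ j, ∀ c : R, c • v j ∈ G → a ∣ c := by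
  classical
  by_contra! h
  choose c hcG hac using h
  refine hG.not_ge (lift_mk_le'.2 ⟨⟨fun j => (⟨c j • v j, hcG j⟩ : G), fun i j hij => ?_⟩⟩)
  by_contra hne
  have relation : Finsupp.linearCombination R v (.single i (c i) - .single j (c j)) = 0 := by
    simpa [sub_eq_zero] using congrArg Subtype.val hij
  exact hac i (by simpa [hne] using (hv _).1 relation i)

theorem single {v : I → M} {a : I → R} (h : ∀ i c, c • v i = 0 ↔ a i ∣ c) :
    LinearIndependentMod a fun i => Finsupp.single i (v i) := by
  classical
  intro f
  have coord (i : I) :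
      Finsupp.linearCombination R (fun i => Finsupp.single i (v i)) f i = f i • v i := by
    simp +contextual [Finsupp.linearCombination_apply, Finsupp.sum_apply, Finsupp.single_apply]
  simp [Finsupp.ext_iff, coord, h]

theorem exists_of_injective_finsupp_zmod {n : ℕ} (f : (J →₀ ZMod n) →+ M)
    (hf : Function.Injective f) :
    ∃ v : J → M, LinearIndependentMod (fun _ => (n : ℤ)) v := by
  have single_one := single (R := ℤ) (v := fun _ : J => (1 : ZMod n))
    (a := fun _ => n) fun _ c => by rw [zsmul_one, ZMod.intCast_zmod_eq_zero_iff_dvd]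
  exact ⟨_, single_one.map f.toIntLinearMap hf⟩

theorem sumElim_inl_inr {a : I → R} {b : J → R} {v : I → M} {w : J → N}
    (hv : LinearIndependentMod a v) (hw : LinearIndependentMod b w) :
    LinearIndependentMod (Sum.elim a b)
      (Sum.elim (LinearMap.inl R M N ∘ v) (LinearMap.inr R M N ∘ w)) := by
  have linearCombination_eq :
      Finsupp.linearCombination R (Sum.elim (LinearMap.inl R M N ∘ v) (LinearMap.inr R M N ∘ w)) =
        .prodMap (Finsupp.linearCombination R v) (Finsupp.linearCombination R w) ∘ₗ
          (Finsupp.sumFinsuppLEquivProdFinsupp R).toLinearMap := by ext (_ | _) <;> simp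
  intro f
  rw [linearCombination_eq]
  simp [Prod.ext_iff, hv _, hw _]

theorem exists_of_forall_exists_const [Countable R] (a : I → R) (hIJ : lift.{w} #I ≤ lift.{v} #J)
    (hJ : ℵ₀ < #J) (h : ∀ i, ∃ v : J → M, LinearIndependentMod (fun _ => a i) v) :
    ∃ v : I → M, LinearIndependentMod a v := by
  obtain ⟨_, _, hord⟩ := exists_ord_eq_type_lt I
  choose e he using h
  have span_lt (i : I) (g : Set.Iio i → M) :
      lift.{w} #(Submodule.span R (Set.range g)) < lift.{u} #J := by
    have range_lt : lift.{w} #(Set.range g) < lift.{u} #J := by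
      rw [← lift_lt.{_, v}, lift_lift, lift_lift]
      calc lift.{max w v} #(Set.range g)
          ≤ lift.{max u w} #(Set.Iio i) := by
            simpa using lift_le.{w}.2 (mk_range_le_lift (f := g))
        _ < lift.{max u w} #I := lift_lt.2 (mk_Iio_lt i hord)
        _ ≤ lift.{max u v} #J := by simpa using lift_le.{u}.2 hIJ
    refine (lift_le.2 (mk_span_le_of_countable R _)).trans_lt ?_
    rw [lift_max, lift_aleph0]
    exact max_lt range_lt (aleph0_lt_lift.2 hJ)
  have step (i : I) (g : Set.Iio i → M) : ∃ x : M, a i • x = 0 ∧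
      ∀ c : R, c • x ∈ Submodule.span R (Set.range g) → a i ∣ c := by
    obtain ⟨j, hj⟩ := (he i).exists_forall_smul_mem_imp_dvd _ (span_lt i g)
    exact ⟨e i j, ((he i).smul_eq_zero_iff j _).2 dvd_rfl, hj⟩
  obtain ⟨v, hv⟩ := exists_forall_domRestrict_Iio step
  refine ⟨v, of_forall_smul_mem_span_imp_dvd (fun i => (hv i).1) fun i => ?_⟩
  rw [← Set.range_domRestrict]
  exact (hv i).2

end LinearIndependentMod
end LinearIndependentMod

noncomputable instance finsuppDivisibleBy (I : Type v) (A : Type w) [AddCommGroup A]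
    [DivisibleBy A ℤ] : DivisibleBy (I →₀ A) ℤ :=
  divisibleByOfSMulRightSurj _ _ fun {n} hn =>
    Finsupp.mapRange_surjective (n • ·) (smul_zero n) (DivisibleBy.surjective_smul A ℤ hn)

theorem exists_comp_eq_of_ker_le {R A H Y : Type*} [Ring R] [AddCommGroup A] [AddCommGroup H]
    [AddCommGroup Y] [Module R A] [Module R H] [Module R Y] (hY : Module.Baer R Y)
    (α : A →ₗ[R] H) (β : A →ₗ[R] Y) (h : α.ker ≤ β.ker) :
    ∃ g : H →ₗ[R] Y, g ∘ₗ α = β := by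
  obtain ⟨g, hg⟩ := hY.extension_property (α.ker.liftQ α le_rfl)
    (LinearMap.ker_eq_bot.1 (Submodule.ker_liftQ_eq_bot _ _ _ le_rfl)) (α.ker.liftQ β h)
  refine ⟨g, LinearMap.ext fun a => ?_⟩
  simpa using DFunLike.congr_fun hg (α.ker.mkQ a)

theorem exists_injective_prod_extending {R A H Y Z : Type*} [Ring R] [AddCommGroup A]
    [AddCommGroup H] [AddCommGroup Y] [AddCommGroup Z] [Module R A] [Module R H] [Module R Y]
    [Module R Z] (hY : Module.Baer R Y) (hZ : Module.Baer R Z) (α : A →ₗ[R] H) (β : A →ₗ[R] Y)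
    (hαβ : α.ker = β.ker) (θ : H →ₗ[R] Z) (hθ : Function.Injective θ) :
    ∃ φ : H →ₗ[R] Y × Z, Function.Injective φ ∧ φ ∘ₗ α = LinearMap.inl R Y Z ∘ₗ β := by
  obtain ⟨g, rfl⟩ := exists_comp_eq_of_ker_le hY α β hαβ.le
  have ker_coprod_le :
      (α.coprod g.ker.subtype).ker ≤ (θ ∘ₗ g.ker.subtype ∘ₗ LinearMap.snd R A g.ker).ker := by
    rintro ⟨a, x, hx⟩ hax
    have hax : α a + x = 0 := hax
    have hga : g (α a) = 0 := by simpa [LinearMap.mem_ker.1 hx] using congrArg g hax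
    have hαa : α a = 0 := hαβ.ge hga
    simpa [hαa] using congrArg θ hax
  obtain ⟨θ', hθ'⟩ := exists_comp_eq_of_ker_le hZ _ _ ker_coprod_le
  have θ'_coprod (a : A) (x : g.ker) : θ' (α a + x) = θ x := DFunLike.congr_fun hθ' (a, x)
  refine ⟨g.prod θ', (injective_iff_map_eq_zero _).2 fun x hx => ?_, LinearMap.ext fun a => ?_⟩
  · obtain ⟨hgx, hθ'x⟩ := Prod.mk.inj hx
    have hθx : θ x = 0 := by simpa [hθ'x] using (θ'_coprod 0 ⟨x, hgx⟩).symm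
    exact (map_eq_zero_iff θ hθ).1 hθx
  · simpa using θ'_coprod a 0

theorem mk_le_mk_dfinsupp {ι : Type v} (β : ι → Type w) [∀ i, AddCommMonoid (β i)]
    [∀ i, Nontrivial (β i)] : lift.{max v w} #ι ≤ lift.{v} #(Π₀ i, β i) := by
  classical
  choose b hb using fun i => exists_ne (0 : β i)
  refine lift_mk_le'.2 ⟨⟨fun i => DFinsupp.single i (b i), fun i j hij => ?_⟩⟩
  rcases (DFinsupp.single_eq_single_iff _ _ _ _).1 hij with h | h
  · exact h.1
  · exact absurd h.1 (hb i)

section Semisimple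

variable {R : Type t} {M : Type u} {E : Type w} [Ring R] [AddCommGroup M] [Module R M]
  [AddCommGroup E] [Module R E] {J : Type v}

theorem exists_injective_finsupp_of_isSemisimpleModule [IsSemisimpleModule R M]
    (hJ : lift.{v} #M ≤ lift.{u} #J)
    (hE : ∀ m : Submodule R M, IsSimpleModule R m → ∃ c : m →ₗ[R] E, c ≠ 0) :
    ∃ f : M →ₗ[R] (J →₀ E), Function.Injective f := by
  classical
  obtain ⟨s, e, -, simple⟩ := IsSemisimpleModule.exists_linearEquiv_dfinsupp R M
  have _ (m : s) : Nontrivial m.1 := IsSimpleModule.nontrivial R m.1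
  have hs : #s ≤ #M := by simpa [mk_congr e.toEquiv] using mk_le_mk_dfinsupp fun m : s => m.1
  obtain ⟨ι⟩ := lift_mk_le'.1 ((lift_le.2 hs).trans hJ)
  choose c hc using fun m : s => hE m.1 (simple m)
  have c_injective (m : s) : Function.Injective (c m) := LinearMap.injective_of_ne_zero (hc m)
  refine ⟨Finsupp.lmapDomain E R ι ∘ₗ (finsuppLequivDFinsupp R).symm.toLinearMap ∘ₗ
    DFinsupp.mapRange.linearMap c ∘ₗ e.toLinearMap, ?_⟩
  exact (Finsupp.mapDomain_injective ι.injective).comp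
    ((finsuppLequivDFinsupp R).symm.injective.comp
      (((DFinsupp.mapRange_injective _ fun m => map_zero _).2 c_injective).comp e.injective))

theorem exists_linearMap_finsupp_disjoint_simple_ker (hEJ : Module.Baer R (J →₀ E))
    (hJ : lift.{v} #M ≤ lift.{u} #J)
    (hE : ∀ m : Submodule R M, IsSimpleModule R m → ∃ c : m →ₗ[R] E, c ≠ 0) :
    ∃ f : M →ₗ[R] (J →₀ E), ∀ m : Submodule R M, IsSimpleModule R m → Disjoint m f.ker := by
  let socle : Submodule R M := ⨆ m ∈ {m : Submodule R M | IsSimpleModule R m}, m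
  have : IsSemisimpleModule R socle := isSemisimpleModule_biSup_of_isSemisimpleModule_submodule
    fun m (hm : IsSimpleModule R m) => inferInstance
  obtain ⟨g, hg⟩ := exists_injective_finsupp_of_isSemisimpleModule (R := R) (M := socle)
    (E := E) ((lift_le.2 (mk_subtype_le (· ∈ socle))).trans hJ) fun m hm => by
      let e := Submodule.equivMapOfInjective socle.subtype socle.injective_subtype m
      obtain ⟨c, hc⟩ := hE _ (IsSimpleModule.congr e.symm)
      exact ⟨c ∘ₗ e, fun h => hc ((LinearMap.cancel_right e.surjective).1 h)⟩
  obtain ⟨f, hf⟩ := hEJ.extension_property socle.subtype socle.injective_subtype g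
  refine ⟨f, fun m hm => Submodule.disjoint_def.2 fun x hx hfx => ?_⟩
  have hx' : x ∈ socle := Submodule.mem_iSup_of_mem m (Submodule.mem_iSup_of_mem hm hx)
  have hgx : g ⟨x, hx'⟩ = 0 := (DFunLike.congr_fun hf (⟨x, hx'⟩ : socle)).symm.trans hfx
  exact congrArg Subtype.val ((map_eq_zero_iff g hg).1 hgx)

theorem exists_isSimpleModule_le (N : Submodule R M) [IsArtinian R N] [Nontrivial N] :
    ∃ m ≤ N, IsSimpleModule R m := by
  obtain ⟨m, hm⟩ := IsAtomic.exists_atom (Submodule R N)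
  have := isSimpleModule_iff_isAtom.2 hm
  exact ⟨m.map N.subtype, N.map_subtype_le m, IsSimpleModule.congr
    (Submodule.equivMapOfInjective N.subtype N.injective_subtype m).symm⟩

end Semisimple

theorem exists_linearMap_finsupp_disjoint_torsion_ker {K : Type u} [AddCommGroup K] {J : Type v}
    (hJ : lift.{v} #K ≤ lift.{u} #J) :
    ∃ f : K →ₗ[ℤ] (J →₀ QmodZ), Disjoint (Submodule.torsion ℤ K) f.ker := by
  obtain ⟨f, hf⟩ := exists_linearMap_finsupp_disjoint_simple_ker (E := QmodZ) (.of_divisible _) hJ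
    fun m hm => by
      have := IsSimpleModule.nontrivial ℤ m
      obtain ⟨x, hx⟩ := exists_ne (0 : m)
      obtain ⟨c, hc⟩ := CharacterModule.exists_character_apply_ne_zero_of_ne_zero hx
      exact ⟨AddMonoidHom.toIntLinearMap c, fun h => hc (DFunLike.congr_fun h x)⟩
  refine ⟨f, Submodule.disjoint_def.2 fun x hx hfx => ?_⟩
  by_contra hx0
  have : Nontrivial (Submodule.span ℤ {x}) := by
    rwa [Submodule.nontrivial_iff_ne_bot, Ne, Submodule.span_singleton_eq_bot]
  have : Finite (Submodule.span ℤ {x}) := by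
    obtain ⟨n, hn⟩ := hx
    rw [← SetLike.coe_sort_coe, ← Submodule.coe_toAddSubgroup,
      Submodule.span_singleton_toAddSubgroup_eq_zmultiples]
    exact finite_zmultiples.2
      (isOfFinAddOrder_iff_zsmul_eq_zero.2 ⟨n, nonZeroDivisors.ne_zero n.2, hn⟩)
  obtain ⟨m, m_le, hm⟩ := exists_isSimpleModule_le (Submodule.span ℤ {x})
  exact (isSimpleModule_iff_isAtom.1 hm).1 ((hf m hm).eq_bot_of_le
    (m_le.trans ((Submodule.span_singleton_le_iff_mem _ _).2 hfx)))

open TensorProduct in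
theorem exists_linearMap_finsupp_ker_le_torsion (A : Type t) (F : Type w) {K : Type u} {J : Type v}
    [CommRing A] [IsDomain A] [Field F] [Algebra A F] [IsFractionRing A F] [AddCommGroup K]
    [Module A K]
    (hJ : lift.{v} (Module.rank A K) ≤ lift.{u} #J) :
    ∃ f : K →ₗ[A] (J →₀ F), f.ker ≤ Submodule.torsion A K := by
  let b := Module.Basis.ofVectorSpace F (F ⊗[A] K)
  have hb : lift.{v} #(Module.Basis.ofVectorSpaceIndex F (F ⊗[A] K)) ≤ lift.{max u w} #J := by
    have rank_eq := (TensorProduct.isBaseChange A K F).lift_rank_eq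
    rw [b.mk_eq_rank'', ← lift_le.{u}, lift_lift, ← lift_lift.{u, v}, rank_eq]
    simpa only [lift_lift] using lift_le.{max u w}.2 hJ
  obtain ⟨ι⟩ := lift_mk_le'.1 hb
  refine ⟨Finsupp.lmapDomain F A ι ∘ₗ b.repr.toLinearMap.restrictScalars A ∘ₗ
    TensorProduct.mk A F K 1, fun x hx => ?_⟩
  have tmul_eq_zero : TensorProduct.mk A F K 1 x = 0 :=
    b.repr.map_eq_zero_iff.1 (Finsupp.mapDomain_injective ι.injective
      (hx.trans (Finsupp.mapDomain_zero).symm))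
  exact (IsLocalizedModule.eq_zero_iff (nonZeroDivisors A) _).1 tmul_eq_zero

theorem exists_injective_finsupp_qmodZ_prod_finsupp_rat {K : Type u} [AddCommGroup K] {J : Type v}
    {J' : Type w} (hJ : lift.{v} #K ≤ lift.{u} #J) (hJ' : lift.{w} #K ≤ lift.{u} #J') :
    ∃ f : K →ₗ[ℤ] (J →₀ QmodZ) × (J' →₀ ℚ), Function.Injective f := by
  obtain ⟨f, hf⟩ := exists_linearMap_finsupp_disjoint_torsion_ker hJ
  obtain ⟨g, hg⟩ := exists_linearMap_finsupp_ker_le_torsion ℤ ℚ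
    ((lift_le.2 (rank_le_card ℤ K)).trans hJ')
  refine ⟨f.prod g, LinearMap.ker_eq_bot.1 ?_⟩
  rw [LinearMap.ker_prod, inf_comm]
  exact (hf.mono_left hg).eq_bot

/-- The family of `1 / n i` in the `i`-th copy of `ℚ / ℤ` and of `1` in the `j`-th copy of `ℚ`. For
`I = P₀` and `J = P₁` these are the elements `[1/n χ_(μ,0)]` and `χ_μ` of `𝐗`. -/
noncomputable def standardFamily {I J : Type*} (n : I → ℕ) :
    I ⊕ J → (I →₀ QmodZ) × (J →₀ ℚ) :=
  Sum.elim (LinearMap.inl ℤ _ _ ∘ fun i => .single i ((1 / n i : ℚ) : QmodZ))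
    (LinearMap.inr ℤ _ _ ∘ fun j => .single j 1)

theorem linearIndependentMod_standardFamily {I J : Type*} {n : I → ℕ} (hn : ∀ i, n i ≠ 0) :
    LinearIndependentMod (Sum.elim (fun i => (n i : ℤ)) fun _ => 0)
      (standardFamily (J := J) n) := by
  refine .sumElim_inl_inr (.single fun i c => ?_) (.single fun _ c => by simp)
  rw [← addOrderOf_dvd_iff_zsmul_eq_zero,
    AddCircle.addOrderOf_period_div (Nat.pos_of_ne_zero (hn i))]

namespace IndexData

variable (S : IndexData)

/-- The embedding into `𝐗` which sends the coordinate `μ ∈ P₀` to the coordinate `(μ, 0)`. -/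
noncomputable def zerothColumn :
    ((S.P₀ →₀ QmodZ) × (S.P₁ →₀ ℚ)) × ((S.R₀ →₀ QmodZ) × (S.R₁ →₀ ℚ)) →+ S.X :=
  AddMonoidHom.codRestrict
    (((Finsupp.mapDomain.addMonoidHom fun μ : S.P₀ => (μ, 0)).prodMap
      (AddMonoidHom.id ((S.P₁ →₀ ℚ) × (S.R₀ →₀ QmodZ) × (S.R₁ →₀ ℚ)))).comp
        (AddEquiv.prodAssoc).toAddMonoidHom) S.X (by
    rintro ⟨⟨a, b⟩, c⟩ ⟨μ, i⟩ hx
    have hmem := Finsupp.mapDomain_support (Finsupp.mem_support_iff.2 hx)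
    obtain ⟨ν, -, hν⟩ := Finset.mem_image.1 hmem
    obtain ⟨rfl, rfl⟩ := Prod.mk.inj hν
    obtain ⟨n, m, hn, hm, hC⟩ := S.C_union.ge ν.2
    exact ⟨n, m, hn, hm, hC, hm⟩)

theorem zerothColumn_apply (a : S.P₀ →₀ QmodZ) (b : S.P₁ →₀ ℚ) (c : S.R₀ →₀ QmodZ)
    (d : S.R₁ →₀ ℚ) :
    (S.zerothColumn ((a, b), (c, d)) : S.W) = (a.mapDomain fun μ => (μ, 0), b, c, d) :=
  rfl

theorem zerothColumn_injective : Function.Injective S.zerothColumn := by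
  rintro ⟨⟨a, b⟩, c, d⟩ ⟨⟨a', b'⟩, c', d'⟩ h
  have h' := congrArg Subtype.val h
  simp only [zerothColumn_apply, Prod.mk.injEq] at h'
  obtain ⟨h_mapDomain, rfl, rfl, rfl⟩ := h'
  rw [Finsupp.mapDomain_injective (fun _ _ h => (Prod.mk.inj h).1) h_mapDomain]

theorem zerothColumn_standardFamily_inl (n : S.P₀ → ℕ) (μ : S.P₀) :
    (S.zerothColumn (standardFamily n (.inl μ), 0) : S.W) =
      S.bracket ((1 / (n μ : ℚ)) • S.chiZero μ 0) := by
  simp [standardFamily, ← Prod.mk_zero_zero, zerothColumn_apply, bracket, chiZero]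

theorem zerothColumn_standardFamily_inr (n : S.P₀ → ℕ) (μ : S.P₁) :
    (S.zerothColumn (standardFamily n (.inr μ), 0) : S.W) = S.bracket (S.chiOne μ) := by
  simp [standardFamily, ← Prod.mk_zero_zero, zerothColumn_apply, bracket, chiOne]

variable {H : Type u} [AddCommGroup H]

theorem exists_linearIndependentMod (hrank : continuum ≤ Module.rank ℤ H) (n : S.P₀ → ℕ)
    (hn : ∀ μ, ∃ f : (ℝ →₀ ZMod (n μ)) →+ H, Function.Injective f) :
    ∃ h : S.P₀ ⊕ S.P₁ → H, LinearIndependentMod (Sum.elim (fun μ => (n μ : ℤ)) fun _ => 0) h := by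
  refine LinearIndependentMod.exists_of_forall_exists_const (J := ℝ) _
    (by simp [mk_real, S.card_P₀, S.card_P₁]) (by simp [mk_real, aleph0_lt_continuum]) ?_
  rintro (μ | _)
  · obtain ⟨f, hf⟩ := hn μ
    exact LinearIndependentMod.exists_of_injective_finsupp_zmod f hf
  · obtain ⟨v, hv⟩ := exists_linearIndependent_of_lift_le_rank ℤ H (J := ℝ) (by simpa [mk_real])
    exact ⟨v, linearIndependentMod_zero_iff.2 hv⟩

theorem exists_injective_bracket_mem_range (hcard : #H ≤ 2 ^ continuum)
    (hrank : continuum ≤ Module.rank ℤ H) (n : S.P₀ → ℕ) (hn : ∀ μ, n μ ≠ 0)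
    (hnH : ∀ μ, ∃ f : (ℝ →₀ ZMod (n μ)) →+ H, Function.Injective f) :
    ∃ φ : H →+ S.X, Function.Injective φ ∧
      (∀ μ : S.P₁, ∃ x ∈ φ.range, (x : S.W) = S.bracket (S.chiOne μ)) ∧
      ∀ μ : S.P₀, ∃ x ∈ φ.range, (x : S.W) = S.bracket ((1 / (n μ : ℚ)) • S.chiZero μ 0) := by
  obtain ⟨h, hh⟩ := S.exists_linearIndependentMod hrank n hnH
  have hcard_le {R : Set Ordinal.{0}} (hR : #R = 2 ^ continuum) :
      lift.{1} #H ≤ lift.{u} #R := by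
    simpa [hR] using lift_le.{1}.2 hcard
  obtain ⟨θ, hθ⟩ := exists_injective_finsupp_qmodZ_prod_finsupp_rat
    (hcard_le S.card_R₀) (hcard_le S.card_R₁)
  obtain ⟨φ, hφ, hφh⟩ := exists_injective_prod_extending (.of_divisible _) (.of_divisible _) _ _
    (hh.ker_linearCombination_eq (linearIndependentMod_standardFamily hn)) θ hθ
  have φ_h (i) : φ (h i) = (standardFamily n i, 0) := by
    simpa using DFunLike.congr_fun hφh (.single i 1)
  refine ⟨S.zerothColumn.comp φ.toAddMonoidHom, S.zerothColumn_injective.comp hφ,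
    fun μ => ⟨_, ⟨h (.inr μ), rfl⟩, ?_⟩, fun μ => ⟨_, ⟨h (.inl μ), rfl⟩, ?_⟩⟩
  · rw [← S.zerothColumn_standardFamily_inr n, ← φ_h]
    rfl
  · rw [← S.zerothColumn_standardFamily_inl n, ← φ_h]
    rfl

theorem exists_order_eq_of_mem_C {k : ℕ → ℕ} (hk : ∀ d ∈ ordersD H, 1 ≤ k d) (μ : S.P₀) :
    ∃ n ≠ 0, (∃ f : (ℝ →₀ ZMod n) →+ H, Function.Injective f) ∧
      ∀ d ∈ ordersD H, (μ : Ordinal.{0}) ∈ S.C d (k d) → n = d := by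
  by_cases hμ : ∃ d ∈ ordersD H, (μ : Ordinal.{0}) ∈ S.C d (k d)
  · obtain ⟨d, hd, hμd⟩ := hμ
    refine ⟨d, (zero_lt_one.trans hd.1).ne', hd.2, fun d' hd' hμd' => ?_⟩
    by_contra hne
    exact Set.disjoint_left.1 (S.C_disjoint _ _ _ _ hd.1 (hk d hd) hd'.1 (hk d' hd')
      fun h => hne (Prod.mk.inj h).1) hμd hμd'
  · exact ⟨1, one_ne_zero, ⟨0, Function.injective_of_subsingleton _⟩,
      fun d hd hμd => absurd ⟨d, hd, hμd⟩ hμ⟩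

theorem exists_injective_bracket_mem_range_of_sizeCondition (hH : SizeCondition H) {k : ℕ → ℕ}
    (hk : ∀ n ∈ ordersD H, 1 ≤ k n) :
    ∃ φ : H →+ S.X, Function.Injective φ ∧
      (∀ μ : S.P₁, ∃ x ∈ φ.range, (x : S.W) = S.bracket (S.chiOne μ)) ∧
      ∀ n ∈ ordersD H, ∀ μ : S.P₀, (μ : Ordinal.{0}) ∈ S.C n (k n) →
        ∃ x ∈ φ.range, (x : S.W) = S.bracket ((1 / (n : ℚ)) • S.chiZero μ 0) := by
  choose n n_ne_zero hnH n_eq using S.exists_order_eq_of_mem_C hk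
  obtain ⟨φ, hφ, chiOne_mem, chiZero_mem⟩ :=
    S.exists_injective_bracket_mem_range hH.1 hH.2.2 n n_ne_zero hnH
  refine ⟨φ, hφ, chiOne_mem, fun d hd μ hμ => ?_⟩
  rw [← n_eq μ d hd hμ]
  exact chiZero_mem μ

end IndexData

section Transfer

variable {G : Type u} {L : Type v} [AddCommGroup G] [AddCommGroup L]

theorem ordersD_subset_of_injective (f : G →+ L) (hf : Function.Injective f) :
    ordersD G ⊆ ordersD L := fun _ ⟨one_lt, g, hg⟩ => ⟨one_lt, f.comp g, hf.comp hg⟩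

theorem ordersD_congr (e : G ≃+ L) : ordersD G = ordersD L :=
  (ordersD_subset_of_injective e.toAddMonoidHom e.injective).antisymm
    (ordersD_subset_of_injective e.symm.toAddMonoidHom e.symm.injective)

theorem SizeCondition.congr (e : G ≃+ L) (h : SizeCondition G) : SizeCondition L := by
  have hcard := lift_mk_eq'.2 ⟨e.toEquiv⟩
  have hrank := e.toIntLinearEquiv.lift_rank_eq
  refine ⟨?_, rank_le_card ℤ L, ?_⟩
  · rw [← lift_le.{u}, ← hcard]
    simpa using lift_le.{v}.2 h.1
  · rw [← continuum_le_lift.{v, u}, ← hrank]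
    exact continuum_le_lift.2 h.2.2

theorem TorsionCondition.congr (e : G ≃+ L) (h : TorsionCondition G) : TorsionCondition L := by
  intro d n hd hn hdn
  have torsion_eq : {y : L | n • y = 0} = e '' {x : G | n • x = 0} := by
    ext y
    rw [← AddEquiv.coe_toEquiv, Equiv.image_eq_preimage_symm]
    simp [← map_nsmul]
  rw [torsion_eq, Set.image_comm fun x => (map_nsmul e d x).symm]
  refine (h d n hd hn hdn).imp (fun finite => finite.image e) fun continuum_le => ?_
  rw [← continuum_le_lift.{v, u}, mk_image_eq_lift _ _ e.injective]
  exact continuum_le_lift.2 continuum_le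

end Transfer

theorem mainTheorem5 (S : IndexData) (H : Type u) [AddCommGroup H] (hH : SizeCondition H) :
    (∃ (k : ℕ → ℕ) (φ : H →+ S.X),
      (∀ n ∈ ordersD H, 1 ≤ k n) ∧
      Function.Injective φ ∧
      (∀ μ : S.P₁, (μ : Ordinal.{0}) ∈ S.C₁ →
        ∃ x ∈ φ.range, (x : S.W) = S.bracket (S.chiOne μ)) ∧
      (∀ n ∈ ordersD H, ∀ μ : S.P₀, (μ : Ordinal.{0}) ∈ S.C n (k n) →
        ∃ x ∈ φ.range, (x : S.W) = S.bracket ((1 / (n : ℚ)) • S.chiZero μ 0))) ∧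
    (TorsionCondition H →
      ∃ L : AddSubgroup S.X, S.IsLarge L ∧ Nonempty (H ≃+ L)) := by
  obtain ⟨φ, hφ, chiOne_mem, chiZero_mem⟩ :=
    S.exists_injective_bracket_mem_range_of_sizeCondition hH (k := fun _ => 1) fun _ _ => le_rfl
  refine ⟨⟨fun _ => 1, φ, fun _ _ => le_rfl, hφ, fun μ _ => chiOne_mem μ, chiZero_mem⟩,
    fun hT => ?_⟩
  let e : H ≃+ φ.range := AddMonoidHom.ofInjective hφ
  rw [ordersD_congr e] at chiZero_mem
  exact ⟨φ.range, ⟨hH.congr e, hT.congr e, fun _ => 1, fun _ _ => le_rfl,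
    fun μ _ => chiOne_mem μ, chiZero_mem⟩, ⟨e⟩⟩
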